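/- Let $1\le p,q<\infty$ be real numbers with $p/q\notin\mathbb{N}$. Write $L_p(L_q)$ for the Banach lattice $L_p([0,1];L_q[0,1])$ of real-valued functions (Lebesgue measure on $[0,1]$), let $\mathbf 1\in L_p(L_q)$ be the constant function $1$, and for $f\in L_p(L_q)$ let $N[f]$ be the function $N[f](s)=\|f(s)\|_{L_q}$ on $[0,1]$. Let $E$ be a Banach lattice that is generated, as a Banach lattice, by finitely many mutually disjoint positive elements $e_1,\dots,e_n$ of norm one. Let $f_1,f_2:E\to L_p(L_q)$ be lattice isometric embeddings (linear isometries, not necessarily onto, that preserve the lattice operations), and suppose that there is a positive element $x\in E$ with $f_1(x)=f_2(x)=\mathbf 1$. Then the tuples $(N[f_1(e_j)])_{j=1}^n$ and $(N[f_2(e_j)])_{j=1}^n$ are equimeasurable, that is, for every Borel set $B\subseteq\mathbb{R}^n$, $$\lambda\bigl\{t\in[0,1]:(N[f_1(e_j)](t))_{j=1}^n\in B\bigr\}=\lambda\bigl\{t\in[0,1]:(N[f_2(e_j)](t))_{j=1}^n\in B\bigr\},$$ where $\lambda$ is Lebesgue measure on $[0,1]$. -/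

import Mathlib

open MeasureTheory
open scoped ENNReal unitInterval

noncomputable section

namespace LpLq

/-- The Banach lattice `L_q = L_q[0,1]` of real-valued functions on the unit interval with Lebesgue
measure. -/
abbrev Lq (q : ℝ≥0∞) : Type := Lp ℝ q (volume : Measure I)

/-- The Bochner space `L_p(L_q) = L_p([0,1]; L_q[0,1])`, with its almost everywhere order and the
norm `‖f‖ = (∫ ‖f s‖_q ^ p ds)^(1/p)`. -/
abbrev LpLqSpace (p q : ℝ≥0∞) [Fact (1 ≤ q)] : Type := Lp (Lq q) p (volume : Measure I)

/-- The constant function `𝟏` in `L_p(L_q)`. -/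
def one (p q : ℝ≥0∞) [Fact (1 ≤ q)] : LpLqSpace p q :=
  Lp.const p (volume : Measure I) (Lp.const q (volume : Measure I) (1 : ℝ))

/-- The random norm `N[f]`, the function `s ↦ ‖f s‖_q` on `[0,1]`
(determined up to null sets by `f`). -/
def randomNorm {p q : ℝ≥0∞} [Fact (1 ≤ q)] (f : LpLqSpace p q) : I → ℝ := fun s => ‖f s‖

/-- Two `n`-tuples of functions on `[0,1]` are equimeasurable if `λ {t | F t ∈ B} = λ {t | G t ∈ B}`
for every Borel set `B ⊆ ℝⁿ`. -/
def Equimeasurable {n : ℕ} (F G : Fin n → I → ℝ) : Prop :=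
  ∀ B : Set (Fin n → ℝ), MeasurableSet B →
    (volume : Measure I) {t | (fun j => F j t) ∈ B} =
      (volume : Measure I) {t | (fun j => G j t) ∈ B}

/-- Tuples in `L_p(L_q)` are base-equimeasurable if the tuples of their random norms are
equimeasurable. -/
def BaseEquimeasurable {p q : ℝ≥0∞} [Fact (1 ≤ q)] {n : ℕ} (f g : Fin n → LpLqSpace p q) : Prop :=
  Equimeasurable (fun j => randomNorm (f j)) (fun j => randomNorm (g j))

section BanachLattice

variable {E F : Type*} [NormedAddCommGroup E] [NormedSpace ℝ E] [Lattice E]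
  [NormedAddCommGroup F] [NormedSpace ℝ F] [Lattice F]

/-- `E` is generated, as a Banach lattice, by `e₁, …, eₙ`: the only closed linear sublattice of `E`
that contains all the `eⱼ` is `E` itself. -/
def IsGeneratedBy {n : ℕ} (e : Fin n → E) : Prop :=
  ∀ S : Submodule ℝ E, IsClosed (S : Set E) →
    (∀ x ∈ S, ∀ y ∈ S, x ⊔ y ∈ S ∧ x ⊓ y ∈ S) → (∀ j, e j ∈ S) → S = ⊤

/-- `E = <e₁, …, eₙ>`: the `eⱼ` are mutually disjoint positive elements of the unit sphere of `E`
that generate `E` as a Banach lattice. -/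
structure IsDisjointlyGeneratedBy {n : ℕ} (e : Fin n → E) : Prop where
  nonneg : ∀ j, 0 ≤ e j
  norm_eq_one : ∀ j, ‖e j‖ = 1
  disjoint : ∀ i j, i ≠ j → |e i| ⊓ |e j| = 0
  generates : IsGeneratedBy e

variable (E F) in
/-- A lattice isometric embedding: a linear isometry (not necessarily onto) that preserves `⊔` and
`⊓`. -/
structure LatticeIsometricEmbedding extends E →ₗᵢ[ℝ] F where
  map_sup : ∀ x y : E, toFun (x ⊔ y) = toFun x ⊔ toFun y
  map_inf : ∀ x y : E, toFun (x ⊓ y) = toFun x ⊓ toFun y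

instance : CoeFun (LatticeIsometricEmbedding E F) (fun _ => E → F) := ⟨fun f => f.toFun⟩

end BanachLattice

end LpLq

end

/-! ### Recovering a joint distribution from fractional moments. -/

namespace LpLq

open Filter Topology

/-! Put `r = p/q` and `G j = N[f (e j)]^q`. The span of the `e j` is a closed sublattice, hence all
of `E`, so `x = ∑ a j • e j`. Disjointness gives `‖∑ c j • f (e j)‖^p = ∫ (∑ |c j|^q G j)^r`; as
`f₁` and `f₂` are isometric, the `r`-th moments of nonnegative combinations of the `G j` agree for
both (`norm_sum_smul_rpow_eq_integral`). The condition `f x = 𝟏` gives `∑ |a j|^q G j = 1`, with all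
`a j ≠ 0`.

Perturbing these coefficients in any direction `b` shows that the means of `(1 + t X)^r` agree for
small `t`, where `X = ∑ b j G j` is bounded. The binomial coefficients of `r ∉ ℕ` never vanish, so
comparing power series in `t` yields all moments of `X`, hence its characteristic function, hence
the joint law of the `G j` (`map_eq_of_integral_rpow_eq`). Taking `q`-th roots finishes. -/

theorem ring_choose_ne_zero {r : ℝ} (hr : ∀ k : ℕ, r ≠ k) (k : ℕ) : Ring.choose r k ≠ 0 := by
  intro h
  have h1 := Ring.descPochhammer_eq_factorial_smul_choose r k
  rw [h, smul_zero, Polynomial.descPochhammer_smeval_eq_ascPochhammer,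
    Polynomial.ascPochhammer_smeval_eq_eval, ← descPochhammer_eval_eq_ascPochhammer,
    descPochhammer_eval_eq_prod_range, Finset.prod_eq_zero_iff] at h1
  obtain ⟨j, -, hj⟩ := h1
  exact hr j (sub_eq_zero.1 hj)

/-- Term by term integration of a power series in a bounded random variable. -/
theorem hasSum_integral_pow_smul {Ω E : Type*} [MeasurableSpace Ω] {μ : Measure Ω}
    [IsFiniteMeasure μ] [NormedAddCommGroup E] [NormedSpace ℝ E] [CompleteSpace E]
    {X : Ω → ℝ} (hX : Measurable X)
    {M : ℝ} (hM : ∀ᵐ ω ∂μ, |X ω| ≤ M) {c : ℕ → E} (hc : Summable fun k => M ^ k * ‖c k‖) {f : ℝ → E}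
    (hf : ∀ x, |x| ≤ M → HasSum (fun k => x ^ k • c k) (f x)) :
    HasSum (fun k => (∫ ω, X ω ^ k ∂μ) • c k) (∫ ω, f (X ω) ∂μ) := by
  simp_rw [← integral_smul_const]
  refine hasSum_integral_of_dominated_convergence (fun k _ => M ^ k * ‖c k‖) (fun k => ?_)
    (fun k => ?_) (.of_forall fun _ => hc) (integrable_const _) ?_
  · exact (hX.pow_const k).aestronglyMeasurable.smul_const (c k)
  · filter_upwards [hM] with ω hω
    rw [norm_smul, norm_pow, Real.norm_eq_abs]
    gcongr
  · filter_upwards [hM] with ω hω using hf _ hω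

/-- The moments of a bounded random variable `X` are determined by the means of `(1 + t X) ^ r` for
small `t`, if `r` is not a natural number. -/
theorem integral_pow_eq_of_integral_rpow_eq {Ω : Type*} [MeasurableSpace Ω] {μ : Measure Ω}
    [IsFiniteMeasure μ] {X Y : Ω → ℝ} (hX : Measurable X) (hY : Measurable Y) {M : ℝ} (hM : 0 < M)
    (hXM : ∀ᵐ ω ∂μ, |X ω| ≤ M) (hYM : ∀ᵐ ω ∂μ, |Y ω| ≤ M) {r : ℝ} (hr : ∀ k : ℕ, r ≠ k)
    (h : ∀ᶠ t in 𝓝 (0 : ℝ), ∫ ω, (1 + t * X ω) ^ r ∂μ = ∫ ω, (1 + t * Y ω) ^ r ∂μ) (k : ℕ) :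
    ∫ ω, X ω ^ k ∂μ = ∫ ω, Y ω ^ k ∂μ := by
  have key : ∀ Z : Ω → ℝ, Measurable Z → (∀ᵐ ω ∂μ, |Z ω| ≤ M) →
      HasFPowerSeriesAt (fun t : ℝ => ∫ ω, (1 + t * Z ω) ^ r ∂μ)
        (.ofScalars ℝ fun k => (∫ ω, Z ω ^ k ∂μ) * Ring.choose r k) 0 := by
    intro Z hZ hZM
    rw [hasFPowerSeriesAt_iff]
    have hs : ∀ x : ℝ, |x| < 1 → HasSum (fun k => x ^ k • Ring.choose r k) ((1 + x) ^ r) := by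
      intro x hx
      have := (Real.one_add_rpow_hasFPowerSeriesOnBall_zero (a := r)).hasSum (y := x)
        (by simpa [enorm_eq_nnnorm, ← NNReal.coe_lt_coe] using hx)
      simpa [binomialSeries, FormalMultilinearSeries.coeff_ofScalars, mul_comm] using this
    -- This radius forces `|t * Z| ≤ 1/2`, well inside the unit disc of the binomial series.
    have hev : ∀ᶠ t in 𝓝 (0 : ℝ), |t| < 1 / (2 * M) := by
      have := Metric.ball_mem_nhds (0 : ℝ) (ε := 1 / (2 * M)) (by positivity)
      filter_upwards [this] with t ht
      simpa using ht
    filter_upwards [hev] with t ht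
    have hb : ∀ᵐ ω ∂μ, |t * Z ω| ≤ 1 / 2 := by
      filter_upwards [hZM] with ω hω
      rw [abs_mul]
      calc |t| * |Z ω| ≤ 1 / (2 * M) * M := by gcongr
        _ = 1 / 2 := by field_simp
    have := hasSum_integral_pow_smul (hZ.const_mul t) hb (c := Ring.choose r)
      (by
        have := (hs (1 / 2) (by norm_num [abs_of_pos])).summable.abs
        simpa [abs_mul] using this)
      (f := fun x => (1 + x) ^ r) (fun x hx => hs x (hx.trans_lt (by norm_num)))
    simp only [zero_add]
    convert this using 2 with k
    simp only [FormalMultilinearSeries.coeff_ofScalars, mul_pow, integral_const_mul, smul_eq_mul]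
    ring
  have := (key X hX hXM).eq_formalMultilinearSeries_of_eventually (key Y hY hYM) h
  have := congrArg (fun p => FormalMultilinearSeries.coeff p k) this
  simp only [FormalMultilinearSeries.coeff_ofScalars] at this
  exact mul_right_cancel₀ (ring_choose_ne_zero hr k) this

/-- The exponential series integrates term by term. Evaluation at frequency `1` suffices, since the
result is applied to every linear functional of the tuple. -/
theorem integral_cexp_eq_of_integral_pow_eq {Ω : Type*} [MeasurableSpace Ω] {μ : Measure Ω}
    [IsFiniteMeasure μ] {X Y : Ω → ℝ} (hX : Measurable X) (hY : Measurable Y) {M : ℝ}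
    (hXM : ∀ᵐ ω ∂μ, |X ω| ≤ M) (hYM : ∀ᵐ ω ∂μ, |Y ω| ≤ M)
    (h : ∀ k : ℕ, ∫ ω, X ω ^ k ∂μ = ∫ ω, Y ω ^ k ∂μ) :
    ∫ ω, Complex.exp (X ω * Complex.I) ∂μ = ∫ ω, Complex.exp (Y ω * Complex.I) ∂μ := by
  have key : ∀ Z : Ω → ℝ, Measurable Z → (∀ᵐ ω ∂μ, |Z ω| ≤ M) →
      HasSum (fun k : ℕ => (∫ ω, Z ω ^ k ∂μ) • (Complex.I ^ k / (k.factorial : ℂ)))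
        (∫ ω, Complex.exp (Z ω * Complex.I) ∂μ) := by
    intro Z hZ hZM
    refine hasSum_integral_pow_smul (f := fun x : ℝ => Complex.exp (x * Complex.I)) hZ hZM ?_ ?_
    · simpa [div_eq_mul_inv] using Real.summable_pow_div_factorial M
    · intro x _
      have := NormedSpace.expSeries_div_hasSum_exp ((x : ℂ) * Complex.I)
      rw [← Complex.exp_eq_exp_ℂ] at this
      have he : (fun k : ℕ => x ^ k • (Complex.I ^ k / (k.factorial : ℂ))) =
          fun k : ℕ => ((x : ℂ) * Complex.I) ^ k / (k.factorial : ℂ) := by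
        ext k
        rw [mul_pow, Complex.real_smul]
        push_cast
        ring
      rwa [he]
  have h1 := key X hX hXM
  simp_rw [h] at h1
  exact h1.unique (key Y hY hYM)

/-- The joint distribution of nonnegative functions, one strictly positive linear combination of
which is `1`, is determined by the `r`-th moments of their positive linear combinations, if `r` is
not a natural number. -/
theorem map_eq_of_integral_rpow_eq {Ω : Type*} [MeasurableSpace Ω] {μ : Measure Ω}
    [IsFiniteMeasure μ] {n : ℕ} {G H : Fin n → Ω → ℝ} (hG : ∀ j, Measurable (G j))
    (hH : ∀ j, Measurable (H j)) (hG0 : ∀ j ω, 0 ≤ G j ω) (hH0 : ∀ j ω, 0 ≤ H j ω)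
    {a : Fin n → ℝ} (ha : ∀ j, 0 < a j) (hG1 : ∀ᵐ ω ∂μ, ∑ j, a j * G j ω = 1)
    (hH1 : ∀ᵐ ω ∂μ, ∑ j, a j * H j ω = 1) {r : ℝ} (hr : ∀ k : ℕ, r ≠ k)
    (h : ∀ b : Fin n → ℝ, (∀ j, 0 ≤ b j) →
      ∫ ω, (∑ j, b j * G j ω) ^ r ∂μ = ∫ ω, (∑ j, b j * H j ω) ^ r ∂μ) :
    μ.map (fun ω j => G j ω) = μ.map (fun ω j => H j ω) := by
  have hGm : Measurable fun ω j => G j ω := measurable_pi_iff.2 hG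
  have hHm : Measurable fun ω j => H j ω := measurable_pi_iff.2 hH
  refine Measure.ext_of_charFunDual ?_
  ext L
  rw [charFunDual_apply, charFunDual_apply, integral_map hGm.aemeasurable (by fun_prop),
    integral_map hHm.aemeasurable (by fun_prop)]
  set b : Fin n → ℝ := fun j => L (Pi.single j 1) with hb
  have hL : ∀ v : Fin n → ℝ, L v = ∑ j, b j * v j := by
    intro v
    conv_lhs => rw [pi_eq_sum_univ' v]
    simp [hb, mul_comm]
  have bound : ∀ K : Fin n → Ω → ℝ, (∀ j ω, 0 ≤ K j ω) → (∀ᵐ ω ∂μ, ∑ j, a j * K j ω = 1) →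
      ∀ᵐ ω ∂μ, |∑ j, b j * K j ω| ≤ 1 + ∑ j, |b j| * (a j)⁻¹ := by
    intro K hK0 hK1
    filter_upwards [hK1] with ω hω
    refine (Finset.abs_sum_le_sum_abs _ _).trans (le_trans (Finset.sum_le_sum fun j _ => ?_)
      (le_add_of_nonneg_left zero_le_one))
    rw [abs_mul, abs_of_nonneg (hK0 j ω)]
    gcongr
    rw [← one_div, le_div_iff₀' (ha j), ← hω]
    exact Finset.single_le_sum (f := fun j => a j * K j ω)
      (fun i _ => mul_nonneg (ha i).le (hK0 i ω)) (Finset.mem_univ j)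
  -- The summand `1` keeps the bound positive even when `b = 0`.
  have hM : 0 < 1 + ∑ j, |b j| * (a j)⁻¹ :=
    add_pos_of_pos_of_nonneg one_pos
      (Finset.sum_nonneg fun j _ => mul_nonneg (abs_nonneg _) (inv_nonneg.2 (ha j).le))
  have hXm : Measurable fun ω => ∑ j, b j * G j ω := by fun_prop
  have hYm : Measurable fun ω => ∑ j, b j * H j ω := by fun_prop
  simp_rw [hL]
  refine integral_cexp_eq_of_integral_pow_eq hXm hYm (bound G hG0 hG1) (bound H hH0 hH1)
    (integral_pow_eq_of_integral_rpow_eq hXm hYm hM (bound G hG0 hG1) (bound H hH0 hH1) hr ?_)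
  have hev : ∀ᶠ t in 𝓝 (0 : ℝ), ∀ j, 0 ≤ a j + t * b j := by
    refine eventually_all.2 fun j => ?_
    have : Tendsto (fun t : ℝ => a j + t * b j) (𝓝 0) (𝓝 (a j + 0 * b j)) :=
      Continuous.tendsto (by fun_prop) 0
    rw [zero_mul, add_zero] at this
    filter_upwards [this.eventually_const_lt (ha j)] with t ht using ht.le
  -- The relation `∑ a j * K j = 1` absorbs the constant `1` into the linear combination.
  have lin : ∀ K : Fin n → Ω → ℝ, (∀ᵐ ω ∂μ, ∑ j, a j * K j ω = 1) → ∀ t : ℝ,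
      ∫ ω, (1 + t * ∑ j, b j * K j ω) ^ r ∂μ = ∫ ω, (∑ j, (a j + t * b j) * K j ω) ^ r ∂μ := by
    intro K hK t
    refine integral_congr_ae ?_
    filter_upwards [hK] with ω hω
    rw [← hω, Finset.mul_sum, ← Finset.sum_add_distrib]
    congr 1
    exact Finset.sum_congr rfl fun j _ => by ring
  filter_upwards [hev] with t ht
  rw [lin G hG1, lin H hH1]
  exact h _ ht

end LpLq

/-! ### Disjoint tuples in `L_q` and `L_p(L_q)`. -/

namespace LpLq

/-- Nonnegative mutually disjoint elements of a lattice. -/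
structure DisjointNonneg {L : Type*} [Lattice L] [Zero L] {n : ℕ} (v : Fin n → L) : Prop where
  nonneg : ∀ j, 0 ≤ v j
  inf_eq_zero : ∀ i j, i ≠ j → v i ⊓ v j = 0

theorem DisjointNonneg.real {n : ℕ} {v : Fin n → ℝ} (hv : DisjointNonneg v) :
    (∀ i, v i = 0) ∨ ∃ j, 0 < v j ∧ ∀ i, i ≠ j → v i = 0 := by
  by_cases h : ∀ i, v i = 0
  · exact .inl h
  · push Not at h
    obtain ⟨j, hj⟩ := h
    have hj' : 0 < v j := lt_of_le_of_ne (hv.nonneg j) hj.symm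
    refine .inr ⟨j, hj', fun i hij => ?_⟩
    rcases min_choice (v i) (v j) with h | h
    · exact h.symm.trans (hv.inf_eq_zero i j hij)
    · exact absurd (h.symm.trans (hv.inf_eq_zero i j hij)) hj

/-- For nonnegative disjoint tuples in `L`, suprema of linear combinations are computed
coefficientwise. -/
def HasCoefficientwiseSup (L : Type*) [Lattice L] [AddCommMonoid L] [Module ℝ L] : Prop :=
  ∀ (n : ℕ) (v : Fin n → L), DisjointNonneg v → ∀ a b : Fin n → ℝ,
    ∑ j, (a j ⊔ b j) • v j = (∑ j, a j • v j) ⊔ ∑ j, b j • v j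

theorem hasCoefficientwiseSup_real : HasCoefficientwiseSup ℝ := by
  intro n v hv a b
  rcases hv.real with h | ⟨j, hj, h⟩
  · simp [h]
  · have hs : ∀ c : Fin n → ℝ, ∑ i, c i • v i = c j * v j := fun c =>
      Finset.sum_eq_single j (fun i _ hij => by simp [h i hij]) (by simp)
    rw [hs, hs, hs, max_mul_of_nonneg _ _ hj.le]

section Lp

variable {Ω E : Type*} [MeasurableSpace Ω] {μ : Measure Ω} [NormedAddCommGroup E]
  {p : ℝ≥0∞}

theorem ae_coeFn_sum_smul [NormedSpace ℝ E] {n : ℕ} (c : Fin n → ℝ) (v : Fin n → Lp E p μ) :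
    ∀ᵐ s ∂μ, (∑ j, c j • v j : Lp E p μ) s = ∑ j, c j • v j s := by
  filter_upwards [Lp.coeFn_fun_finsetSum Finset.univ fun j => c j • v j,
    ae_all_iff.2 fun j => Lp.coeFn_smul (c j) (v j)] with s h1 h2
  rw [h1]
  exact Finset.sum_congr rfl fun j _ => h2 j

theorem norm_rpow_eq_integral (hp0 : p ≠ 0) (hp : p ≠ ∞) (f : Lp E p μ) :
    ‖f‖ ^ p.toReal = ∫ s, ‖f s‖ ^ p.toReal ∂μ := by
  have hi : 0 ≤ ∫ s, ‖f s‖ ^ p.toReal ∂μ := integral_nonneg fun s => by positivity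
  rw [Lp.norm_def, (Lp.memLp f).eLpNorm_eq_integral_rpow_norm hp0 hp,
    ENNReal.toReal_ofReal (by positivity),
    Real.rpow_inv_rpow hi (ENNReal.toReal_pos hp0 hp).ne']

variable [Lattice E] [HasSolidNorm E] [IsOrderedAddMonoid E]

theorem DisjointNonneg.ae {n : ℕ} {v : Fin n → Lp E p μ} (hv : DisjointNonneg v) :
    ∀ᵐ s ∂μ, DisjointNonneg fun j => v j s := by
  have h1 : ∀ᵐ s ∂μ, ∀ j, 0 ≤ v j s := ae_all_iff.2 fun j => (Lp.coeFn_nonneg _).2 (hv.nonneg j)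
  have h2 : ∀ᵐ s ∂μ, ∀ i j, i ≠ j → v i s ⊓ v j s = 0 := by
    refine ae_all_iff.2 fun i => ae_all_iff.2 fun j => ?_
    by_cases hij : i = j
    · simp [hij]
    · have h := Lp.coeFn_inf (v i) (v j)
      rw [hv.inf_eq_zero i j hij] at h
      filter_upwards [h, Lp.coeFn_zero E p μ] with s hs h0 _
      exact hs.symm.trans h0
  filter_upwards [h1, h2] with s hs1 hs2 using ⟨hs1, hs2⟩

/-- The property passes through almost every fibre; applied twice, it climbs from `ℝ` to `L_q` to
`L_p(L_q)`. -/
theorem HasCoefficientwiseSup.lp [NormedSpace ℝ E] (h : HasCoefficientwiseSup E) :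
    HasCoefficientwiseSup (Lp E p μ) := by
  intro n v hv a b
  refine Lp.ext ?_
  filter_upwards [hv.ae, ae_coeFn_sum_smul (fun j => a j ⊔ b j) v, ae_coeFn_sum_smul a v,
    ae_coeFn_sum_smul b v, Lp.coeFn_sup (∑ j, a j • v j) (∑ j, b j • v j)] with s hs h1 h2 h3 h4
  rw [h1, h4, Pi.sup_apply, h2, h3]
  exact h n _ hs a b

end Lp

section Lq

variable {Ω : Type*} [MeasurableSpace Ω] {μ : Measure Ω} {q : ℝ≥0∞} {n : ℕ}

/-- At almost every point at most one `v j` is nonzero, so the `q`-th power of the sum splits. -/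
theorem norm_sum_smul_rpow [Fact (1 ≤ q)] (hq : q ≠ ∞) {v : Fin n → Lp ℝ q μ}
    (hv : DisjointNonneg v) (c : Fin n → ℝ) :
    ‖∑ j, c j • v j‖ ^ q.toReal = ∑ j, |c j| ^ q.toReal * ‖v j‖ ^ q.toReal := by
  have hq0 : q ≠ 0 := (zero_lt_one.trans_le Fact.out).ne'
  have hq' : q.toReal ≠ 0 := (ENNReal.toReal_pos hq0 hq).ne'
  simp_rw [norm_rpow_eq_integral hq0 hq, ← integral_const_mul]
  rw [← integral_finsetSum _ fun j _ =>
    ((Lp.memLp (v j)).integrable_norm_rpow hq0 hq).const_mul _]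
  refine integral_congr_ae ?_
  filter_upwards [hv.ae, ae_coeFn_sum_smul c v] with t ht hc
  rw [hc]
  rcases ht.real with h | ⟨j, hj, h⟩
  · simp [h, Real.zero_rpow hq']
  · rw [Finset.sum_eq_single j (fun i _ hij => by simp [h i hij]) (by simp),
      Finset.sum_eq_single j (fun i _ hij => by simp [h i hij, Real.zero_rpow hq']) (by simp),
      norm_smul, Real.mul_rpow (norm_nonneg _) (norm_nonneg _), Real.norm_eq_abs (c j)]

/-- Where `v j` is nonzero the other terms vanish, so `a j = 0` would make the sum `0` there instead
of `1`. -/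
theorem eq_zero_of_sum_smul_eq_one [IsFiniteMeasure μ] {v : Fin n → Lp ℝ q μ}
    (hv : DisjointNonneg v) {a : Fin n → ℝ} (h : ∑ j, a j • v j = Lp.const q μ (1 : ℝ)) {j : Fin n}
    (hj : a j = 0) : v j = 0 := by
  refine Lp.ext ?_
  have hone := Lp.coeFn_const (p := q) (μ := μ) (c := (1 : ℝ))
  rw [← h] at hone
  filter_upwards [hv.ae, ae_coeFn_sum_smul a v, hone, Lp.coeFn_zero ℝ q μ] with t ht h1 h2 h0
  rw [h0]
  rcases ht.real with h | ⟨k, hk, h⟩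
  · exact h j
  · refine h j ?_
    rintro rfl
    rw [h1, Finset.sum_eq_single j (fun i _ hij => by simp [h i hij]) (by simp), hj] at h2
    simp at h2

end Lq

section LpLq

variable {p q : ℝ≥0∞} [Fact (1 ≤ q)] {n : ℕ} {v : Fin n → LpLqSpace p q}

theorem norm_sum_smul_rpow_eq_integral [Fact (1 ≤ p)] (hp : p ≠ ∞) (hq : q ≠ ∞) (hv : DisjointNonneg v)
    (c : Fin n → ℝ) :
    ‖∑ j, c j • v j‖ ^ p.toReal =
      ∫ s, (∑ j, |c j| ^ q.toReal * ‖v j s‖ ^ q.toReal) ^ (p.toReal / q.toReal) := by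
  have hp0 : p ≠ 0 := (zero_lt_one.trans_le Fact.out).ne'
  have hq0 : q ≠ 0 := (zero_lt_one.trans_le Fact.out).ne'
  have hq' : q.toReal ≠ 0 := (ENNReal.toReal_pos hq0 hq).ne'
  rw [norm_rpow_eq_integral hp0 hp]
  refine integral_congr_ae ?_
  filter_upwards [hv.ae, ae_coeFn_sum_smul c v] with s hs hc
  rw [hc, ← norm_sum_smul_rpow hq hs, ← Real.rpow_mul (norm_nonneg _), mul_div_cancel₀ _ hq']

theorem ae_sum_smul_eq_one {a : Fin n → ℝ} (h : ∑ j, a j • v j = one p q) :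
    ∀ᵐ s, ∑ j, a j • v j s = Lp.const q (volume : Measure I) (1 : ℝ) := by
  have hone := Lp.coeFn_const (p := p) (μ := (volume : Measure I))
    (c := Lp.const q (volume : Measure I) (1 : ℝ))
  change (one p q : I → Lq q) =ᵐ[_] _ at hone
  rw [← h] at hone
  filter_upwards [ae_coeFn_sum_smul a v, hone] with s h1 h2
  rw [← h1, h2]
  rfl

theorem ne_zero_of_sum_smul_eq_one (hv : DisjointNonneg v) {a : Fin n → ℝ}
    (h : ∑ j, a j • v j = one p q) {j : Fin n} (hj : v j ≠ 0) : a j ≠ 0 := by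
  intro ha
  refine hj (Lp.ext ?_)
  filter_upwards [hv.ae, ae_sum_smul_eq_one h, Lp.coeFn_zero (Lq q) p volume] with s hs h1 h0
  rw [h0]
  exact eq_zero_of_sum_smul_eq_one hs h1 ha

theorem ae_sum_mul_norm_rpow_eq_one (hq : q ≠ ∞) (hv : DisjointNonneg v) {a : Fin n → ℝ}
    (h : ∑ j, a j • v j = one p q) :
    ∀ᵐ s, ∑ j, |a j| ^ q.toReal * ‖v j s‖ ^ q.toReal = 1 := by
  filter_upwards [hv.ae, ae_sum_smul_eq_one h] with s hs h1
  have hq0 : q ≠ 0 := (zero_lt_one.trans_le Fact.out).ne'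
  have hone : ‖Lp.const q (volume : Measure I) (1 : ℝ)‖ = 1 := by
    simpa using Lp.norm_const' q (volume : Measure I) (1 : ℝ) hq0 hq
  rw [← norm_sum_smul_rpow hq hs, h1]
  exact (congrArg (· ^ q.toReal) hone).trans (Real.one_rpow _)

end LpLq

/-! ### Lattice embeddings and the span of the generators. -/

section Embedding

variable {E : Type*} [NormedAddCommGroup E] [NormedSpace ℝ E] [Lattice E] {n : ℕ} {e : Fin n → E}

theorem DisjointNonneg.map {F : Type*} [NormedAddCommGroup F] [NormedSpace ℝ F] [Lattice F]
    (he : DisjointNonneg e) (f : LatticeIsometricEmbedding E F) :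
    DisjointNonneg fun j => f (e j) := by
  have h0 : f 0 = 0 := f.toLinearIsometry.map_zero
  refine ⟨fun j => ?_, fun i j hij => ?_⟩
  · rw [← sup_eq_right, ← h0, ← f.map_sup, sup_eq_right.2 (he.nonneg j)]
  · rw [← f.map_inf, he.inf_eq_zero i j hij, h0]

theorem LatticeIsometricEmbedding.map_sum_smul {F : Type*} [NormedAddCommGroup F] [NormedSpace ℝ F]
    [Lattice F] (f : LatticeIsometricEmbedding E F) (c : Fin n → ℝ) :
    f (∑ j, c j • e j) = ∑ j, c j • f (e j) := by
  change f.toLinearIsometry (∑ j, c j • e j) = ∑ j, c j • f.toLinearIsometry (e j)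
  simp

theorem IsDisjointlyGeneratedBy.disjointNonneg [IsOrderedAddMonoid E]
    (he : IsDisjointlyGeneratedBy e) :
    DisjointNonneg e where
  nonneg := he.nonneg
  inf_eq_zero i j hij := by
    have := he.disjoint i j hij
    rwa [abs_of_nonneg (he.nonneg i), abs_of_nonneg (he.nonneg j)] at this

/-- A Banach lattice generated by finitely many disjoint positive elements is their linear span, if
it embeds into a lattice in which suprema of disjoint combinations are coefficientwise. -/
theorem IsDisjointlyGeneratedBy.exists_eq_sum_smul [IsOrderedAddMonoid E]
    (he : IsDisjointlyGeneratedBy e)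
    {F : Type*} [NormedAddCommGroup F] [NormedSpace ℝ F] [Lattice F]
    (hF : HasCoefficientwiseSup F) (f : LatticeIsometricEmbedding E F) (x : E) :
    ∃ a : Fin n → ℝ, ∑ j, a j • e j = x := by
  rw [← Submodule.mem_span_range_iff_exists_fun ℝ]
  set S := Submodule.span ℝ (Set.range e) with hS
  have : FiniteDimensional ℝ S := FiniteDimensional.span_of_finite ℝ (Set.finite_range e)
  have hsup : ∀ x ∈ S, ∀ y ∈ S, x ⊔ y ∈ S := by
    intro x hx y hy
    rw [hS, Submodule.mem_span_range_iff_exists_fun] at *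
    obtain ⟨a, rfl⟩ := hx
    obtain ⟨b, rfl⟩ := hy
    -- The identity is checked in `F`, where suprema are coefficientwise, and pulled back by
    -- injectivity.
    refine ⟨fun j => a j ⊔ b j, f.toLinearIsometry.injective ?_⟩
    change f _ = f _
    rw [f.map_sup, f.map_sum_smul, f.map_sum_smul, f.map_sum_smul]
    exact hF n _ (he.disjointNonneg.map f) a b
  have hinf : ∀ x ∈ S, ∀ y ∈ S, x ⊓ y ∈ S := by
    intro x hx y hy
    have h : x ⊓ y = x + y - (x ⊔ y) := by rw [← inf_add_sup x y, add_sub_cancel_right]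
    rw [h]
    exact S.sub_mem (S.add_mem hx hy) (hsup x hx y hy)
  have := he.generates S S.closed_of_finiteDimensional
    (fun x hx y hy => ⟨hsup x hx y hy, hinf x hx y hy⟩)
    (fun j => Submodule.subset_span (Set.mem_range_self j))
  rw [this]
  trivial

end Embedding

end LpLq

theorem mainTheorem5 (p q : ℝ≥0∞) [Fact (1 ≤ p)] [Fact (1 ≤ q)] (hp : p ≠ ∞) (hq : q ≠ ∞)
    (hr : ∀ k : ℕ, p.toReal / q.toReal ≠ (k : ℝ))
    {E : Type*} [NormedAddCommGroup E] [NormedSpace ℝ E] [CompleteSpace E]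
    [Lattice E] [IsOrderedAddMonoid E] [IsOrderedModule ℝ E] [HasSolidNorm E]
    {n : ℕ} (e : Fin n → E) (he : LpLq.IsDisjointlyGeneratedBy e)
    (f₁ f₂ : LpLq.LatticeIsometricEmbedding E (LpLq.LpLqSpace p q))
    (x : E) (hx : 0 ≤ x) (h₁ : f₁ x = LpLq.one p q) (h₂ : f₂ x = LpLq.one p q) :
    LpLq.BaseEquimeasurable (fun j => f₁ (e j)) (fun j => f₂ (e j)) := by
  have hq0 : q ≠ 0 := (zero_lt_one.trans_le Fact.out).ne'
  have hq' : 0 < q.toReal := ENNReal.toReal_pos hq0 hq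
  obtain ⟨a, rfl⟩ := he.exists_eq_sum_smul LpLq.hasCoefficientwiseSup_real.lp.lp f₁ x
  rw [f₁.map_sum_smul] at h₁
  rw [f₂.map_sum_smul] at h₂
  have hd₁ := he.disjointNonneg.map f₁
  have hd₂ := he.disjointNonneg.map f₂
  have ha : ∀ j, a j ≠ 0 := fun j => LpLq.ne_zero_of_sum_smul_eq_one hd₁ h₁ fun h0 => by
    have h := f₁.toLinearIsometry.norm_map (e j)
    rw [he.norm_eq_one j, show f₁.toLinearIsometry (e j) = 0 from h0, norm_zero] at h
    exact zero_ne_one h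
  have hm : ∀ f : LpLq.LpLqSpace p q, Measurable fun s => ‖f s‖ ^ q.toReal := fun f =>
    (Lp.stronglyMeasurable f).norm.measurable.pow_const _
  have hmap := LpLq.map_eq_of_integral_rpow_eq (μ := (volume : Measure I))
    (G := fun j s => ‖f₁ (e j) s‖ ^ q.toReal) (H := fun j s => ‖f₂ (e j) s‖ ^ q.toReal)
    (fun j => hm _) (fun j => hm _) (fun j s => by positivity) (fun j s => by positivity)
    (a := fun j => |a j| ^ q.toReal) (fun j => Real.rpow_pos_of_pos (abs_pos.2 (ha j)) _)
    (LpLq.ae_sum_mul_norm_rpow_eq_one hq hd₁ h₁) (LpLq.ae_sum_mul_norm_rpow_eq_one hq hd₂ h₂)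
    hr fun b hb => by
      -- Every nonnegative coefficient is a `q`-th power, so each moment is the norm of an image of
      -- an element of `E`.
      obtain ⟨c, rfl⟩ : ∃ c : Fin n → ℝ, b = fun j => |c j| ^ q.toReal :=
        ⟨fun j => b j ^ q.toReal⁻¹, funext fun j => by
          rw [abs_of_nonneg (Real.rpow_nonneg (hb j) _), Real.rpow_inv_rpow (hb j) hq'.ne']⟩
      rw [← LpLq.norm_sum_smul_rpow_eq_integral hp hq hd₁,
        ← LpLq.norm_sum_smul_rpow_eq_integral hp hq hd₂, ← f₁.map_sum_smul, ← f₂.map_sum_smul]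
      congr 1
      exact (f₁.toLinearIsometry.norm_map _).trans (f₂.toLinearIsometry.norm_map _).symm
  intro B hB
  have hroot : Measurable fun (v : Fin n → ℝ) j => v j ^ q.toReal⁻¹ :=
    measurable_pi_iff.2 fun j => (measurable_pi_apply j).pow_const _
  have key : ∀ f : Fin n → LpLq.LpLqSpace p q,
      volume {t | (fun j => LpLq.randomNorm (f j) t) ∈ B} =
        (volume.map fun s j => ‖f j s‖ ^ q.toReal) ((fun v j => v j ^ q.toReal⁻¹) ⁻¹' B) := by
    intro f
    rw [Measure.map_apply (measurable_pi_iff.2 fun j => hm _) (hroot hB), ← Set.preimage_comp]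
    congr 1
    ext t
    simp only [Set.mem_ofPred_eq, Set.mem_preimage, Function.comp_apply, LpLq.randomNorm,
      Real.rpow_rpow_inv (norm_nonneg _) hq'.ne']
  rw [key, key, hmap]
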